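/- Let $K$ be an algebraically closed field that is complete with respect to a nontrivial nonarchimedean absolute value $|\cdot|$, let $\|x\|=\max_i|x_i|$ on $K^{N+1}$, and equip $\mathbb{P}^N(K)$ with the chordal metric $$\Delta(P,Q)=\frac{\max_{0\le i,j\le N}|x_iy_j-x_jy_i|}{\|x\|\,\|y\|}\qquad(P=[x],\ Q=[y]),$$ and write $D_r(P)=\{Q\in\mathbb{P}^N(K):\Delta(P,Q)<r\}$. Let $\varphi:\mathbb{P}^N_K\to\mathbb{P}^N_K$ be a morphism of degree $d\ge 2$. A lift of $\varphi$ is a tuple $\Phi=(\Phi_0,\dots,\Phi_N)$ of homogeneous polynomials of degree $d$ in $K[X_0,\dots,X_N]$ without nontrivial common zero that induces $\varphi$; $\|\Phi\|$ denotes the maximum of the absolute values of the coefficients of $\Phi_0,\dots,\Phi_N$, and $\Phi$ is a minimal lift if $\|\Phi\|=1$. Let $|\operatorname{Res}(\varphi)|$ be the absolute value of the Macaulay resultant of a minimal lift of $\varphi$ (it does not depend on the minimal lift). For a lift $\Phi$ put $g_\Phi(P)=\frac1d\log\|\Phi(x)\|-\log\|x\|$, where $P=[x]$. The morphism $\varphi$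 has good reduction at $P$ if there are a lift $\Phi$ of $\varphi$ and a lift $x$ of $P$ with $\|x\|=\|\Phi\|=\|\Phi(x)\|=1$; let $U^{\mathrm{good}}(\varphi)$ be the set of all such points $P$. Let $\Phi$ be a minimal lift of $\varphi$ and let $P\in\mathbb{P}^N(K)$. Consider the statements: (a) $P\in U^{\mathrm{good}}(\varphi)$. (b) $D_{|\operatorname{Res}(\varphi)|}(P)\subset U^{\mathrm{good}}(\varphi)$. (c) $g_\Phi(P)=0$. (d) $\Delta(\varphi(Q),\varphi(R))\le\Delta(Q,R)$ for all $Q,R\in D_{|\operatorname{Res}(\varphi)|}(P)$. (e) There is a neighborhood $U$ of $P$ such that $\Delta(\varphi(Q),\varphi(R))\le\Delta(Q,R)$ for all $Q,R\in U$. Then (a) $\Leftrightarrow$ (b) $\Leftrightarrow$ (c) $\Rightarrow$ (d) $\Rightarrow$ (e). In particular, $U^{\mathrm{good}}(\varphi)$ is an open subset of $\mathbb{P}^N(K)$. -/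

import Mathlib

open scoped LinearAlgebra.Projectivization

noncomputable section

namespace GoodReduction

/-! ### Projective space over a nonarchimedean field and the chordal metric -/

/-- `ℙ^N(K)`: lines in `K^{N+1}`. Vectors of `K^{N+1}` carry the sup norm. -/
abbrev PSpace (K : Type*) [Field K] (N : ℕ) : Type _ := ℙ K (Fin (N + 1) → K)

/-- The chordal distance computed on vectors: the maximum over `i`, `j` of
`|x_i y_j - x_j y_i|`, divided by `‖x‖ ‖y‖`. -/
def chordalAux {K : Type*} [NormedField K] {N : ℕ} (x y : Fin (N + 1) → K) : ℝ :=
  ‖fun p : Fin (N + 1) × Fin (N + 1) => x p.1 * y p.2 - x p.2 * y p.1‖ / (‖x‖ * ‖y‖)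

theorem chordalAux_smul_smul {K : Type*} [NormedField K] {N : ℕ} (a b : Kˣ)
    (x y : Fin (N + 1) → K) : chordalAux (a • x) (b • y) = chordalAux x y := by
  have ha : ‖(a : K)‖ ≠ 0 := norm_ne_zero_iff.2 a.ne_zero
  have hb : ‖(b : K)‖ ≠ 0 := norm_ne_zero_iff.2 b.ne_zero
  have h : (fun p : Fin (N + 1) × Fin (N + 1) =>
      (a • x) p.1 * (b • y) p.2 - (a • x) p.2 * (b • y) p.1) =
      ((a : K) * (b : K)) • fun p : Fin (N + 1) × Fin (N + 1) =>
        x p.1 * y p.2 - x p.2 * y p.1 := by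
    funext p
    simp only [Pi.smul_apply, Units.smul_def, smul_eq_mul]
    ring
  unfold chordalAux
  rw [h, norm_smul, norm_mul, Units.smul_def, Units.smul_def, norm_smul, norm_smul,
    show ‖(a : K)‖ * ‖x‖ * (‖(b : K)‖ * ‖y‖) = (‖(a : K)‖ * ‖(b : K)‖) * (‖x‖ * ‖y‖) by ring,
    mul_div_mul_left _ _ (mul_ne_zero ha hb)]

/-- The chordal distance `Δ(P, Q)` on `ℙ^N(K)`. -/
def chordalDist {K : Type*} [NormedField K] {N : ℕ} (P Q : PSpace K N) : ℝ :=
  chordalAux P.rep Q.rep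

/-- The chordal distance may be computed with any lifts. -/
theorem chordalDist_mk {K : Type*} [NormedField K] {N : ℕ} (x y : Fin (N + 1) → K)
    (hx : x ≠ 0) (hy : y ≠ 0) :
    chordalDist (Projectivization.mk K x hx) (Projectivization.mk K y hy) = chordalAux x y := by
  obtain ⟨a, ha⟩ := Projectivization.exists_smul_eq_mk_rep K x hx
  obtain ⟨b, hb⟩ := Projectivization.exists_smul_eq_mk_rep K y hy
  rw [chordalDist, ← ha, ← hb, chordalAux_smul_smul]

theorem chordalAux_comm {K : Type*} [NormedField K] {N : ℕ} (x y : Fin (N + 1) → K) :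
    chordalAux x y = chordalAux y x := by
  unfold chordalAux
  rw [mul_comm ‖x‖, ← norm_neg]
  congr 2
  funext p
  simp only [Pi.neg_apply]
  ring

theorem le_chordalAux {K : Type*} [NormedField K] {N : ℕ} (x y : Fin (N + 1) → K)
    (i j : Fin (N + 1)) :
    ‖x i * y j - x j * y i‖ ≤ chordalAux x y * (‖x‖ * ‖y‖) := by
  by_cases hx : x = 0
  · simp [hx]
  by_cases hy : y = 0
  · simp [hy]
  unfold chordalAux
  rw [div_mul_cancel₀ _ (mul_ne_zero (norm_ne_zero_iff.2 hx) (norm_ne_zero_iff.2 hy))]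
  exact norm_le_pi_norm (fun p : Fin (N + 1) × Fin (N + 1) => x p.1 * y p.2 - x p.2 * y p.1) (i, j)

/-- The strong triangle inequality for the chordal distance. -/
theorem chordalAux_triangle {K : Type*} [NormedField K] [IsUltrametricDist K] {N : ℕ}
    (x y z : Fin (N + 1) → K) (hx : x ≠ 0) (hy : y ≠ 0) (hz : z ≠ 0) :
    chordalAux x z ≤ max (chordalAux x y) (chordalAux y z) := by
  obtain ⟨j, hj⟩ : ∃ j, ‖y‖ = ‖y j‖ := by
    obtain ⟨j, -, hj⟩ := Finset.exists_mem_eq_sup' Finset.univ_nonempty fun j => ‖y j‖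
    refine ⟨j, le_antisymm ?_ (norm_le_pi_norm y j)⟩
    rw [pi_norm_le_iff_of_nonneg (norm_nonneg _)]
    intro i
    rw [← hj]
    exact Finset.le_sup' (fun j => ‖y j‖) (Finset.mem_univ i)
  have hx' := norm_pos_iff.2 hx
  have hy' := norm_pos_iff.2 hy
  have hz' := norm_pos_iff.2 hz
  set M := max (chordalAux x y) (chordalAux y z) with hM
  have hM0 : 0 ≤ M := le_max_of_le_left (by unfold chordalAux; positivity)
  rw [chordalAux, div_le_iff₀ (mul_pos hx' hz')]
  rw [pi_norm_le_iff_of_nonneg (by positivity)]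
  rintro ⟨i, k⟩
  have key : (x i * z k - x k * z i) * y j =
      (x i * y j - x j * y i) * z k + (y i * z k - y k * z i) * x j
        + (x j * y k - x k * y j) * z i := by ring
  have h1 : ∀ a b c : Fin (N + 1), ‖(x a * y b - x b * y a) * z c‖ ≤ M * (‖x‖ * ‖z‖) * ‖y‖ := by
    intro a b c
    rw [norm_mul]
    calc ‖x a * y b - x b * y a‖ * ‖z c‖ ≤ (chordalAux x y * (‖x‖ * ‖y‖)) * ‖z‖ :=
          mul_le_mul (le_chordalAux x y a b) (norm_le_pi_norm z c) (norm_nonneg _)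
            ((norm_nonneg _).trans (le_chordalAux x y a b))
      _ ≤ (M * (‖x‖ * ‖y‖)) * ‖z‖ := by gcongr; exact le_max_left _ _
      _ = _ := by ring
  have h2 : ‖(y i * z k - y k * z i) * x j‖ ≤ M * (‖x‖ * ‖z‖) * ‖y‖ := by
    rw [norm_mul]
    calc ‖y i * z k - y k * z i‖ * ‖x j‖ ≤ (chordalAux y z * (‖y‖ * ‖z‖)) * ‖x‖ :=
          mul_le_mul (le_chordalAux y z i k) (norm_le_pi_norm x j) (norm_nonneg _)
            ((norm_nonneg _).trans (le_chordalAux y z i k))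
      _ ≤ (M * (‖y‖ * ‖z‖)) * ‖x‖ := by gcongr; exact le_max_right _ _
      _ = _ := by ring
  have h3 : ‖(x i * z k - x k * z i) * y j‖ ≤ M * (‖x‖ * ‖z‖) * ‖y‖ := by
    rw [key]
    refine (IsUltrametricDist.norm_add_le_max _ _).trans (max_le ?_ (h1 _ _ _))
    exact (IsUltrametricDist.norm_add_le_max _ _).trans (max_le (h1 _ _ _) h2)
  rw [norm_mul, ← hj] at h3
  exact le_of_mul_le_mul_right h3 hy'

/-- `ℙ^N(K)` as a metric space, with the chordal metric. -/
instance chordalMetric {K : Type*} [NormedField K] [IsUltrametricDist K] {N : ℕ} :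
    MetricSpace (PSpace K N) where
  dist := chordalDist
  dist_self P := by
    have : (fun p : Fin (N + 1) × Fin (N + 1) =>
        P.rep p.1 * P.rep p.2 - P.rep p.2 * P.rep p.1) = 0 := by
      funext p
      simp [mul_comm]
    simp [chordalDist, chordalAux, this]
  dist_comm P Q := chordalAux_comm _ _
  dist_triangle P Q R := by
    refine (chordalAux_triangle P.rep Q.rep R.rep P.rep_nonzero Q.rep_nonzero
      R.rep_nonzero).trans (max_le_add_of_nonneg ?_ ?_) <;>
    · unfold chordalAux
      positivity
  eq_of_dist_eq_zero {P Q} h := by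
    have hz : ∀ i j, P.rep i * Q.rep j = P.rep j * Q.rep i := by
      intro i j
      have h' := le_chordalAux P.rep Q.rep i j
      rw [show chordalAux P.rep Q.rep = 0 from h, zero_mul] at h'
      exact sub_eq_zero.1 (norm_le_zero_iff.1 h')
    obtain ⟨j, hj⟩ := Function.ne_iff.1 Q.rep_nonzero
    rw [← P.mk_rep, ← Q.mk_rep, Projectivization.mk_eq_mk_iff']
    refine ⟨P.rep j / Q.rep j, ?_⟩
    funext i
    simp only [Pi.smul_apply, smul_eq_mul]
    rw [div_mul_eq_mul_div, ← hz, mul_div_assoc, div_self hj, mul_one]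

theorem dist_eq_chordalDist {K : Type*} [NormedField K] [IsUltrametricDist K] {N : ℕ}
    (P Q : PSpace K N) : dist P Q = chordalDist P Q := rfl

/-- The open disk `D_r(P) = {Q : Δ(P, Q) < r}`. -/
def disk {K : Type*} [NormedField K] {N : ℕ} (P : PSpace K N) (r : ℝ) : Set (PSpace K N) :=
  {Q | chordalDist P Q < r}

/-! ### Morphisms of projective space and their lifts -/

/-- The map `K^{N+1} → K^{N+1}` given by an `(N+1)`-tuple of polynomials. -/
def evalMap {K : Type*} [Field K] {N : ℕ} (Φ : Fin (N + 1) → MvPolynomial (Fin (N + 1)) K)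
    (x : Fin (N + 1) → K) : Fin (N + 1) → K :=
  fun i => MvPolynomial.eval x (Φ i)

/-- `Φ` is a lift of degree `d` of the self-map `f` of `ℙ^N(K)`: its components are homogeneous
of degree `d`, have no common zero other than the origin, and `f [x] = [Φ(x)]`. -/
def IsLift {K : Type*} [Field K] {N : ℕ} (d : ℕ)
    (Φ : Fin (N + 1) → MvPolynomial (Fin (N + 1)) K) (f : PSpace K N → PSpace K N) : Prop :=
  (∀ i, (Φ i).IsHomogeneous d) ∧
    ∀ (x : Fin (N + 1) → K) (hx : x ≠ 0), ∃ h : evalMap Φ x ≠ 0,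
      f (Projectivization.mk K x hx) = Projectivization.mk K (evalMap Φ x) h

/-- Morphisms `ℙ^N → ℙ^N` of degree `d` over an algebraically closed field `K`, given by their
(determining) action on the `K`-points: the maps induced by `N+1` forms of degree `d` without
nontrivial common zero. -/
structure ProjMorphism (K : Type*) [Field K] (N d : ℕ) where
  /-- the action on points -/
  toFun : PSpace K N → PSpace K N
  exists_lift : ∃ Φ : Fin (N + 1) → MvPolynomial (Fin (N + 1)) K, IsLift d Φ toFun

/-- The norm `‖Φ‖`: the maximum of the absolute values of all the coefficients of `Φ`. -/
def coeffNorm {K : Type*} [NormedField K] {N : ℕ}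
    (Φ : Fin (N + 1) → MvPolynomial (Fin (N + 1)) K) : ℝ :=
  ((Finset.univ.sup fun i => (Φ i).support.sup fun α => ‖(Φ i).coeff α‖₊ : NNReal) : ℝ)

/-- A minimal lift: all coefficients are `K`-integral and at least one is a `K`-unit. -/
def IsMinimalLift {K : Type*} [NormedField K] {N d : ℕ} (φ : ProjMorphism K N d)
    (Φ : Fin (N + 1) → MvPolynomial (Fin (N + 1)) K) : Prop :=
  IsLift d Φ φ.toFun ∧ (∀ i α, ‖(Φ i).coeff α‖ ≤ 1) ∧ ∃ i α, ‖(Φ i).coeff α‖ = 1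

/-! ### The Macaulay resultant of `N+1` forms of degree `d` in `N+1` variables -/

/-- The exponents of degree `d` in `N+1` variables. -/
abbrev Expo (N d : ℕ) : Type :=
  ((Finset.univ : Finset (Fin (N + 1))).finsuppAntidiag d : Finset (Fin (N + 1) →₀ ℕ))

/-- `ℤ[u]`, one indeterminate `u_{i,α}` for each coefficient of `N+1` forms of degree `d`. -/
abbrev CoeffRing (N d : ℕ) : Type := MvPolynomial (Fin (N + 1) × Expo N d) ℤ

/-- The generic form `F_i = ∑_α u_{i,α} X^α` of degree `d`. -/
def genericForm (N d : ℕ) (i : Fin (N + 1)) : MvPolynomial (Fin (N + 1)) (CoeffRing N d) :=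
  ∑ α : Expo N d, MvPolynomial.monomial (α : Fin (N + 1) →₀ ℕ) (MvPolynomial.X (i, α))

/-- The resultant ideal (inertia forms of degree `0`): all `a ∈ ℤ[u]` such that `a X_j^k`, for
some `k` and all `j`, lies in the ideal of `ℤ[u][X]` generated by the generic forms. -/
def resultantIdeal (N d : ℕ) : Ideal (CoeffRing N d) where
  carrier := {a | ∃ k : ℕ, ∀ j : Fin (N + 1),
    MvPolynomial.C a * MvPolynomial.X j ^ k ∈ Ideal.span (Set.range (genericForm N d))}
  zero_mem' := ⟨0, fun j => by simp⟩
  add_mem' := by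
    rintro a b ⟨k, hk⟩ ⟨l, hl⟩
    refine ⟨k + l, fun j => ?_⟩
    have h1 := Ideal.mul_mem_right (MvPolynomial.X j ^ l) _ (hk j)
    have h2 := Ideal.mul_mem_right (MvPolynomial.X j ^ k) _ (hl j)
    convert add_mem h1 h2 using 1
    rw [map_add]
    ring
  smul_mem' := by
    rintro c a ⟨k, hk⟩
    refine ⟨k, fun j => ?_⟩
    convert Ideal.mul_mem_left _ (MvPolynomial.C c) (hk j) using 1
    rw [smul_eq_mul, map_mul, mul_assoc]

/-- The elements of the resultant ideal have a greatest common divisor. -/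
theorem exists_gcd_resultantIdeal (N d : ℕ) :
    ∃ g : CoeffRing N d, ∀ b, b ∣ g ↔ ∀ a ∈ resultantIdeal N d, b ∣ a := by
  classical
  obtain ⟨S, hS⟩ := (isNoetherianRing_iff_ideal_fg _).1
    (inferInstance : IsNoetherianRing (CoeffRing N d)) (resultantIdeal N d)
  let _ : StrongNormalizationMonoid (CoeffRing N d) :=
    UniqueFactorizationMonoid.strongNormalizationMonoid
  let _ : NormalizedGCDMonoid (CoeffRing N d) :=
    UniqueFactorizationMonoid.toNormalizedGCDMonoid _
  refine ⟨S.gcd id, fun b => ?_⟩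
  rw [Finset.dvd_gcd_iff]
  constructor
  · intro h a ha
    rw [← Ideal.mem_span_singleton]
    refine (?_ : resultantIdeal N d ≤ Ideal.span {b}) ha
    rw [← hS, Ideal.span_le]
    exact fun s hs => Ideal.mem_span_singleton.2 (h s hs)
  · intro h s hs
    exact h s (hS ▸ Ideal.subset_span hs)

/-- A greatest common divisor of the resultant ideal. The resultant ideal is principal and the
Macaulay resultant is its generator, so this is the Macaulay resultant up to sign. -/
def preResultant (N d : ℕ) : CoeffRing N d := (exists_gcd_resultantIdeal N d).choose

theorem dvd_preResultant_iff (N d : ℕ) (b : CoeffRing N d) :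
    b ∣ preResultant N d ↔ ∀ a ∈ resultantIdeal N d, b ∣ a :=
  (exists_gcd_resultantIdeal N d).choose_spec b

/-- The value of `q ∈ ℤ[u]` at the coefficients of the tuple `Φ`. -/
def evalCoeffs {R : Type*} [CommRing R] {N d : ℕ} (q : CoeffRing N d)
    (Φ : Fin (N + 1) → MvPolynomial (Fin (N + 1)) R) : R :=
  MvPolynomial.aeval (fun p : Fin (N + 1) × Expo N d =>
    (Φ p.1).coeff (p.2 : Fin (N + 1) →₀ ℕ)) q

/-- The Macaulay resultant in `ℤ[u]`, with the sign such that its value at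
`(X_0^d, …, X_N^d)` is not negative (that value is `1`). -/
def resultantPoly (N d : ℕ) : CoeffRing N d :=
  if evalCoeffs (R := ℤ) (preResultant N d) (fun i => MvPolynomial.X i ^ d) < 0
  then -preResultant N d else preResultant N d

/-- `Res(Φ)`, for a tuple `Φ` of `N+1` forms of degree `d` in `N+1` variables. -/
def resultant {K : Type*} [Field K] {N : ℕ} (d : ℕ)
    (Φ : Fin (N + 1) → MvPolynomial (Fin (N + 1)) K) : K :=
  evalCoeffs (resultantPoly N d) Φ

/-- `ρ` is a minimal resultant `Res(φ)` of `φ`: the resultant of a minimal lift. -/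
def IsMinimalResultant {K : Type*} [NormedField K] {N d : ℕ} (φ : ProjMorphism K N d)
    (ρ : K) : Prop :=
  ∃ Φ, IsMinimalLift φ Φ ∧ resultant d Φ = ρ

/-! ### Good reduction and the function `g_Φ` -/

/-- `φ` has good reduction at `P`: there are a lift `Φ` of `φ` and a lift `x` of `P` with
`‖x‖ = 1`, `‖Φ‖ = 1` and `‖Φ(x)‖ = 1`. -/
def HasGoodReductionAt {K : Type*} [NormedField K] {N d : ℕ} (φ : ProjMorphism K N d)
    (P : PSpace K N) : Prop :=
  ∃ Φ : Fin (N + 1) → MvPolynomial (Fin (N + 1)) K, IsLift d Φ φ.toFun ∧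
    ∃ (x : Fin (N + 1) → K) (hx : x ≠ 0), Projectivization.mk K x hx = P ∧
      ‖x‖ = 1 ∧ coeffNorm Φ = 1 ∧ ‖evalMap Φ x‖ = 1

/-- `U^good(φ)`, the set of points of good reduction. -/
def goodLocus {K : Type*} [NormedField K] {N d : ℕ} (φ : ProjMorphism K N d) :
    Set (PSpace K N) :=
  {P | HasGoodReductionAt φ P}

/-- `g_Φ(P) = (1/d) log ‖Φ(x)‖ - log ‖x‖`, for a lift `x` of `P`. -/
def gFun {K : Type*} [NormedField K] {N : ℕ} (d : ℕ)
    (Φ : Fin (N + 1) → MvPolynomial (Fin (N + 1)) K) (P : PSpace K N) : ℝ :=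
  (1 / (d : ℝ)) * Real.log ‖evalMap Φ P.rep‖ - Real.log ‖P.rep‖

theorem evalMap_smul {K : Type*} [Field K] {N d : ℕ}
    {Φ : Fin (N + 1) → MvPolynomial (Fin (N + 1)) K} (hΦ : ∀ i, (Φ i).IsHomogeneous d)
    (c : K) (x : Fin (N + 1) → K) : evalMap Φ (c • x) = c ^ d • evalMap Φ x := by
  funext i
  simp only [evalMap, Pi.smul_apply, smul_eq_mul, MvPolynomial.eval_eq, Finset.mul_sum]
  refine Finset.sum_congr rfl fun α hα => ?_
  have hd : ∑ j ∈ α.support, α j = d := by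
    have := hΦ i (MvPolynomial.mem_support_iff.1 hα)
    rwa [Finsupp.weight_apply, Finsupp.sum, Finset.sum_congr rfl fun j _ => by
      rw [Pi.one_apply, smul_eq_mul, mul_one]] at this
  rw [← hd, ← Finset.prod_pow_eq_pow_sum]
  simp only [mul_pow, Finset.prod_mul_distrib]
  ring

/-- `g_Φ(P)` may be computed with any lift of `P`. -/
theorem gFun_mk {K : Type*} [NormedField K] {N d : ℕ} (hd : d ≠ 0)
    {Φ : Fin (N + 1) → MvPolynomial (Fin (N + 1)) K} {f : PSpace K N → PSpace K N}
    (hΦ : IsLift d Φ f) (x : Fin (N + 1) → K) (hx : x ≠ 0) :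
    gFun d Φ (Projectivization.mk K x hx) =
      (1 / (d : ℝ)) * Real.log ‖evalMap Φ x‖ - Real.log ‖x‖ := by
  obtain ⟨a, ha⟩ := Projectivization.exists_smul_eq_mk_rep K x hx
  have ha0 : ‖(a : K)‖ ≠ 0 := norm_ne_zero_iff.2 a.ne_zero
  have hd0 : (d : ℝ) ≠ 0 := Nat.cast_ne_zero.2 hd
  obtain ⟨h, -⟩ := hΦ.2 x hx
  rw [gFun, ← ha, Units.smul_def, evalMap_smul hΦ.1, norm_smul, norm_smul, norm_pow,
    Real.log_mul (pow_ne_zero _ ha0) (norm_ne_zero_iff.2 h),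
    Real.log_mul ha0 (norm_ne_zero_iff.2 hx), Real.log_pow]
  field_simp
  ring

/-- `φ` is nonexpanding on `U` for the chordal metric. -/
def NonexpandingOn {K : Type*} [NormedField K] {N d : ℕ} (φ : ProjMorphism K N d)
    (U : Set (PSpace K N)) : Prop :=
  ∀ Q ∈ U, ∀ R ∈ U, chordalDist (φ.toFun Q) (φ.toFun R) ≤ chordalDist Q R

end GoodReduction

end

open GoodReduction

/-!
Forms with integral coefficients do not expand distances on the unit polydisk, and a point at
chordal distance `δ < 1` from `[x]`, `‖x‖ = 1`, has a lift of norm `1` at distance at most `δ` from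
`x`. Hence `‖Φ(x)‖ = 1` persists on the open unit disk around a point of good reduction, and there
`Δ(φ(Q), φ(R)) ≤ ‖Φ(x) - Φ(y)‖ ≤ ‖x - y‖ ≤ Δ(Q, R)`. Since `Δ ≤ 1` everywhere, such a `Q` satisfies
`Δ(φ(Q), φ(R)) ≤ Δ(Q, R)` for every `R`.

To test good reduction on the given lift one needs that lifts are unique up to a scalar. On a line
that misses the origin two lifts restrict to proportional tuples of univariate polynomials without
common root, and by Bézout the factor is a constant; comparing all points with one fixed point gives
the same constant everywhere.

Finally `0 < |Res(φ)| ≤ 1`. By the Nullstellensatz the forms of a lift generate all forms of some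
degree `D`, so some maximal minor of the Macaulay matrix of the generic forms in degree `D` does not
vanish at the lift. By Cramer's rule this minor is in the resultant ideal, so the resultant
divides it.
-/

namespace GoodReduction

open MvPolynomial

section IntegralPolynomials

variable {R σ : Type*} [NormedCommRing R] [NormOneClass R] [IsUltrametricDist R]

theorem norm_prod_sub_prod_le {ι : Type*} (s : Finset ι) {a b : ι → R} {r : ℝ} (hr : 0 ≤ r)
    (ha : ∀ i, ‖a i‖ ≤ 1) (hb : ∀ i, ‖b i‖ ≤ 1) (hab : ∀ i, ‖a i - b i‖ ≤ r) :
    ‖∏ i ∈ s, a i - ∏ i ∈ s, b i‖ ≤ r := by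
  classical
  induction s using Finset.induction_on with
  | empty => simpa
  | insert i s hi ih =>
    have hprod : ‖∏ i ∈ s, b i‖ ≤ 1 :=
      (Finset.norm_prod_le s b).trans
        (Finset.prod_le_one (fun _ _ => norm_nonneg _) fun i _ => hb i)
    have htelescope : a i * ∏ i ∈ s, a i - b i * ∏ i ∈ s, b i =
        a i * (∏ i ∈ s, a i - ∏ i ∈ s, b i) + (a i - b i) * ∏ i ∈ s, b i := by ring
    rw [Finset.prod_insert hi, Finset.prod_insert hi, htelescope]
    refine (IsUltrametricDist.norm_add_le_max _ _).trans (max_le ?_ ?_)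
    · exact (norm_mul_le _ _).trans ((mul_le_of_le_one_left (norm_nonneg _) (ha i)).trans ih)
    · exact (norm_mul_le _ _).trans ((mul_le_of_le_one_right (norm_nonneg _) hprod).trans (hab i))

theorem norm_eval_le_one {p : MvPolynomial σ R} (hp : ∀ α, ‖p.coeff α‖ ≤ 1) {x : σ → R}
    (hx : ∀ i, ‖x i‖ ≤ 1) : ‖eval x p‖ ≤ 1 := by
  rw [eval_eq]
  refine IsUltrametricDist.norm_sum_le_of_forall_le_of_nonneg zero_le_one fun α _ => ?_
  have hmonomial : ‖∏ i ∈ α.support, x i ^ α i‖ ≤ 1 :=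
    (Finset.norm_prod_le _ _).trans <| Finset.prod_le_one (fun _ _ => norm_nonneg _) fun i _ =>
      (norm_pow_le _ _).trans (pow_le_one₀ (norm_nonneg _) (hx i))
  exact (norm_mul_le _ _).trans (mul_le_one₀ (hp α) (norm_nonneg _) hmonomial)

theorem norm_eval_sub_eval_le {p : MvPolynomial σ R} (hp : ∀ α, ‖p.coeff α‖ ≤ 1) {x y : σ → R}
    {r : ℝ} (hr : 0 ≤ r) (hx : ∀ i, ‖x i‖ ≤ 1) (hy : ∀ i, ‖y i‖ ≤ 1)
    (hxy : ∀ i, ‖x i - y i‖ ≤ r) : ‖eval x p - eval y p‖ ≤ r := by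
  have hpow_le : ∀ {z : R}, ‖z‖ ≤ 1 → ∀ n : ℕ, ‖z ^ n‖ ≤ 1 := fun hz n =>
    (norm_pow_le _ n).trans (pow_le_one₀ (norm_nonneg _) hz)
  have hpow_sub : ∀ i (n : ℕ), ‖x i ^ n - y i ^ n‖ ≤ r := fun i n => by
    simpa using norm_prod_sub_prod_le (Finset.range n) hr (a := fun _ => x i) (b := fun _ => y i)
      (fun _ => hx i) (fun _ => hy i) fun _ => hxy i
  rw [eval_eq, eval_eq, ← Finset.sum_sub_distrib]
  refine IsUltrametricDist.norm_sum_le_of_forall_le_of_nonneg hr fun α _ => ?_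
  rw [← mul_sub]
  refine (norm_mul_le _ _).trans ((mul_le_of_le_one_left (norm_nonneg _) (hp α)).trans ?_)
  exact norm_prod_sub_prod_le _ hr (fun i => hpow_le (hx i) _) (fun i => hpow_le (hy i) _)
    fun i => hpow_sub i _

theorem norm_aeval_int_le_one (q : MvPolynomial σ ℤ) {u : σ → R} (hu : ∀ i, ‖u i‖ ≤ 1) :
    ‖aeval u q‖ ≤ 1 := by
  rw [aeval_def, eval₂_eq_eval_map]
  refine norm_eval_le_one (fun α => ?_) hu
  rw [coeff_map, eq_intCast]
  exact IsUltrametricDist.norm_intCast_le_one R _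

end IntegralPolynomials

section ChordalDistance

theorem exists_norm_apply_eq {ι E : Type*} [Fintype ι] [Nonempty ι] [SeminormedAddCommGroup E]
    (x : ι → E) : ∃ i, ‖x i‖ = ‖x‖ := by
  obtain ⟨i, -, hi⟩ := Finset.exists_mem_eq_sup Finset.univ Finset.univ_nonempty (‖x ·‖₊)
  exact ⟨i, by rw [Pi.norm_def, hi, coe_nnnorm]⟩

theorem norm_mul_sub_mul_le {ι R : Type*} [Fintype ι] [SeminormedCommRing R]
    [IsUltrametricDist R] (x y : ι → R) (i j : ι) :
    ‖x i * y j - x j * y i‖ ≤ ‖x‖ * ‖y‖ := by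
  have hle : ∀ i j, ‖x i * y j‖ ≤ ‖x‖ * ‖y‖ := fun i j =>
    (norm_mul_le _ _).trans (mul_le_mul (norm_le_pi_norm x i) (norm_le_pi_norm y j)
      (norm_nonneg _) (norm_nonneg _))
  rw [sub_eq_add_neg]
  refine (IsUltrametricDist.norm_add_le_max _ _).trans (max_le (hle i j) ?_)
  rw [norm_neg]
  exact hle j i

variable {K : Type*} [NormedField K] {N : ℕ}

theorem chordalAux_nonneg (x y : Fin (N + 1) → K) : 0 ≤ chordalAux x y := by
  unfold chordalAux
  positivity

variable [IsUltrametricDist K]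

theorem chordalAux_le_one (x y : Fin (N + 1) → K) : chordalAux x y ≤ 1 :=
  div_le_one_of_le₀ ((pi_norm_le_iff_of_nonneg (by positivity)).2 fun p =>
    norm_mul_sub_mul_le x y p.1 p.2) (by positivity)

theorem chordalAux_le_norm_sub_div (x : Fin (N + 1) → K) {y : Fin (N + 1) → K} (hy : y ≠ 0) :
    chordalAux x y ≤ ‖x - y‖ / ‖x‖ := by
  rw [chordalAux, ← mul_div_mul_right ‖x - y‖ ‖x‖ (norm_ne_zero_iff.2 hy)]
  gcongr
  refine (pi_norm_le_iff_of_nonneg (by positivity)).2 fun p => ?_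
  have hminor : x p.1 * y p.2 - x p.2 * y p.1 = (x - y) p.1 * y p.2 - (x - y) p.2 * y p.1 := by
    simp only [Pi.sub_apply]
    ring
  exact hminor ▸ norm_mul_sub_mul_le (x - y) y p.1 p.2

theorem norm_apply_eq_norm_of_chordalAux_lt_one {x y : Fin (N + 1) → K} (hx : x ≠ 0)
    (hxy : chordalAux x y < 1) {i : Fin (N + 1)} (hi : ‖x i‖ = ‖x‖) : ‖y i‖ = ‖y‖ := by
  obtain ⟨j, hj⟩ := exists_norm_apply_eq y
  by_contra hne
  have hlt : ‖y i‖ < ‖y‖ := (norm_le_pi_norm y i).lt_of_ne hne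
  have hmul_lt : ‖x j * y i‖ < ‖x i * y j‖ := by
    rw [norm_mul, norm_mul, hi, hj]
    exact mul_lt_mul_of_le_of_lt_of_nonneg_of_pos (norm_le_pi_norm x j) hlt (norm_nonneg _)
      (norm_pos_iff.2 hx)
  have hminor : ‖x i * y j - x j * y i‖ < ‖x i * y j‖ := by
    refine (le_chordalAux x y i j).trans_lt ?_
    rw [norm_mul, hi, hj]
    exact mul_lt_of_lt_one_left
      (mul_pos (norm_pos_iff.2 hx) ((norm_nonneg _).trans_lt hlt)) hxy
  have hnorm : ‖x i * y j‖ = ‖x j * y i‖ := by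
    rw [← norm_neg (x j * y i)]
    apply IsUltrametricDist.norm_eq_of_add_norm_lt_max
    rw [← sub_eq_add_neg]
    exact lt_max_of_lt_left hminor
  exact hmul_lt.ne' hnorm

theorem exists_lift_norm_sub_le {x : Fin (N + 1) → K} (hx : x ≠ 0) {Q : PSpace K N}
    (hQ : chordalDist (.mk K x hx) Q < 1) :
    ∃ (y : Fin (N + 1) → K) (hy : y ≠ 0), .mk K y hy = Q ∧ ‖y‖ = ‖x‖ ∧
      ‖x - y‖ ≤ chordalDist (.mk K x hx) Q * ‖x‖ := by
  induction Q using Projectivization.ind with | h z hz => ?_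
  rw [chordalDist_mk] at hQ ⊢
  obtain ⟨i, hi⟩ := exists_norm_apply_eq x
  have hzi : ‖z i‖ = ‖z‖ := norm_apply_eq_norm_of_chordalAux_lt_one hx hQ hi
  have hxi0 : x i ≠ 0 := norm_ne_zero_iff.1 (hi ▸ norm_ne_zero_iff.2 hx)
  have hzi0 : z i ≠ 0 := norm_ne_zero_iff.1 (hzi ▸ norm_ne_zero_iff.2 hz)
  have hc : x i / z i ≠ 0 := div_ne_zero hxi0 hzi0
  refine ⟨(x i / z i) • z, smul_ne_zero hc hz,
    (Projectivization.mk_eq_mk_iff' K _ _ _ _).2 ⟨_, rfl⟩, ?_, ?_⟩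
  · rw [norm_smul, norm_div, hi, hzi, div_mul_cancel₀ _ (norm_ne_zero_iff.2 hz)]
  · refine (pi_norm_le_iff_of_nonneg (mul_nonneg (chordalAux_nonneg x z) (norm_nonneg x))).2
      fun k => ?_
    have hminor : (x - (x i / z i) • z) k = (x k * z i - x i * z k) / z i := by
      simp only [Pi.sub_apply, Pi.smul_apply, smul_eq_mul]
      field_simp
    rw [hminor, norm_div, hzi, div_le_iff₀ (norm_pos_iff.2 hz), mul_assoc]
    exact le_chordalAux x z k i

theorem disk_mem_nhds (P : PSpace K N) {r : ℝ} (hr : 0 < r) : disk P r ∈ nhds P := by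
  filter_upwards [Metric.ball_mem_nhds P hr] with Q hQ
  rwa [Metric.mem_ball'] at hQ

end ChordalDistance

section CoeffNorm

variable {K : Type*} [NormedField K] {N : ℕ}
  (Φ : Fin (N + 1) → MvPolynomial (Fin (N + 1)) K)

theorem norm_coeff_le_coeffNorm (i : Fin (N + 1)) (α : Fin (N + 1) →₀ ℕ) :
    ‖(Φ i).coeff α‖ ≤ coeffNorm Φ := by
  by_cases hα : α ∈ (Φ i).support
  · exact NNReal.coe_le_coe.2 <|
      (Finset.le_sup (f := fun α => ‖(Φ i).coeff α‖₊) hα).trans <|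
        Finset.le_sup (f := fun i => (Φ i).support.sup fun α => ‖(Φ i).coeff α‖₊)
          (Finset.mem_univ i)
  · rw [notMem_support_iff.1 hα, norm_zero]
    exact NNReal.coe_nonneg _

theorem exists_norm_coeff_eq_coeffNorm : ∃ i α, ‖(Φ i).coeff α‖ = coeffNorm Φ := by
  obtain ⟨i, -, hi⟩ := Finset.exists_mem_eq_sup Finset.univ Finset.univ_nonempty
    fun i => (Φ i).support.sup fun α => ‖(Φ i).coeff α‖₊
  rw [coeffNorm, hi]
  rcases (Φ i).support.eq_empty_or_nonempty with hempty | hne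
  · exact ⟨i, 0, by simp [support_eq_empty.1 hempty]⟩
  · obtain ⟨α, -, hα⟩ := Finset.exists_mem_eq_sup _ hne fun α => ‖(Φ i).coeff α‖₊
    exact ⟨i, α, by rw [hα, coe_nnnorm]⟩

theorem coeffNorm_C_mul (c : K) : coeffNorm (fun i => C c * Φ i) = ‖c‖ * coeffNorm Φ := by
  refine le_antisymm ?_ ?_
  · obtain ⟨i, α, hα⟩ := exists_norm_coeff_eq_coeffNorm fun i => C c * Φ i
    rw [← hα, coeff_C_mul, norm_mul]
    exact mul_le_mul_of_nonneg_left (norm_coeff_le_coeffNorm Φ i α) (norm_nonneg c)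
  · obtain ⟨i, α, hα⟩ := exists_norm_coeff_eq_coeffNorm Φ
    rw [← hα, ← norm_mul, ← coeff_C_mul]
    exact norm_coeff_le_coeffNorm (fun i => C c * Φ i) i α

variable {Φ} {d : ℕ} {φ : ProjMorphism K N d}

theorem isMinimalLift_iff_coeffNorm_eq_one :
    IsMinimalLift φ Φ ↔ IsLift d Φ φ.toFun ∧ coeffNorm Φ = 1 := by
  refine and_congr_right fun _ => ⟨?_, fun h => ?_⟩
  · rintro ⟨hle, i, α, hα⟩
    obtain ⟨j, β, hβ⟩ := exists_norm_coeff_eq_coeffNorm Φ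
    exact le_antisymm (hβ ▸ hle j β) (hα ▸ norm_coeff_le_coeffNorm Φ i α)
  · exact h ▸ ⟨norm_coeff_le_coeffNorm Φ, exists_norm_coeff_eq_coeffNorm Φ⟩

end CoeffNorm

section GoodLocus

variable {K : Type*} [NormedField K] [IsUltrametricDist K] {N d : ℕ}
  {Φ : Fin (N + 1) → MvPolynomial (Fin (N + 1)) K} {x y : Fin (N + 1) → K}
  {φ : ProjMorphism K N d} {P : PSpace K N}

theorem norm_evalMap_sub_le (hΦ : coeffNorm Φ ≤ 1) (hx : ‖x‖ ≤ 1) (hy : ‖y‖ ≤ 1) :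
    ‖evalMap Φ x - evalMap Φ y‖ ≤ ‖x - y‖ :=
  (pi_norm_le_iff_of_nonneg (norm_nonneg _)).2 fun i =>
    norm_eval_sub_eval_le (fun α => (norm_coeff_le_coeffNorm Φ i α).trans hΦ) (norm_nonneg _)
      (fun j => (norm_le_pi_norm x j).trans hx) (fun j => (norm_le_pi_norm y j).trans hy)
      fun j => norm_le_pi_norm (x - y) j

theorem norm_evalMap_eq_of_norm_sub_lt (hΦ : coeffNorm Φ ≤ 1) (hx : ‖x‖ ≤ 1) (hy : ‖y‖ ≤ 1)
    (hxy : ‖x - y‖ < ‖evalMap Φ x‖) : ‖evalMap Φ y‖ = ‖evalMap Φ x‖ := by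
  rw [eq_comm, ← norm_neg (evalMap Φ y)]
  apply IsUltrametricDist.norm_eq_of_add_norm_lt_max
  rw [← sub_eq_add_neg]
  exact lt_max_of_lt_left ((norm_evalMap_sub_le hΦ hx hy).trans_lt hxy)

theorem HasGoodReductionAt.exists_lifts_of_dist_lt_one (hP : HasGoodReductionAt φ P)
    {Q : PSpace K N} (hQ : chordalDist P Q < 1) :
    ∃ Φ, IsLift d Φ φ.toFun ∧ coeffNorm Φ = 1 ∧
      ∃ (x y : Fin (N + 1) → K) (hx : x ≠ 0) (hy : y ≠ 0), .mk K x hx = P ∧ .mk K y hy = Q ∧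
        ‖x‖ = 1 ∧ ‖y‖ = 1 ∧ ‖x - y‖ ≤ chordalDist P Q ∧ ‖evalMap Φ x‖ = 1 ∧ ‖evalMap Φ y‖ = 1 := by
  obtain ⟨Φ, hlift, x, hx0, rfl, hx, hΦ, hΦx⟩ := hP
  obtain ⟨y, hy0, hyQ, hy, hxy⟩ := exists_lift_norm_sub_le hx0 hQ
  rw [hx] at hy
  rw [hx, mul_one] at hxy
  have hΦy : ‖evalMap Φ y‖ = 1 := hΦx ▸ norm_evalMap_eq_of_norm_sub_lt hΦ.le hx.le hy.le
    (hΦx ▸ hxy.trans_lt hQ)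
  exact ⟨Φ, hlift, hΦ, x, y, hx0, hy0, rfl, hyQ, hx, hy, hxy, hΦx, hΦy⟩

theorem disk_subset_goodLocus (hP : P ∈ goodLocus φ) {r : ℝ} (hr : r ≤ 1) :
    disk P r ⊆ goodLocus φ := by
  intro Q hQ
  obtain ⟨Φ, hlift, hΦ, -, y, -, hy0, -, hyQ, -, hy, -, -, hΦy⟩ :=
    HasGoodReductionAt.exists_lifts_of_dist_lt_one hP (hQ.trans_le hr)
  exact ⟨Φ, hlift, y, hy0, hyQ, hy, hΦ, hΦy⟩

theorem isOpen_goodLocus (φ : ProjMorphism K N d) : IsOpen (goodLocus φ) :=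
  isOpen_iff_mem_nhds.2 fun P hP =>
    Filter.mem_of_superset (disk_mem_nhds P one_pos) (disk_subset_goodLocus hP le_rfl)

theorem nonexpandingOn_goodLocus (φ : ProjMorphism K N d) : NonexpandingOn φ (goodLocus φ) := by
  intro Q hQ R _
  rcases lt_or_ge (chordalDist Q R) 1 with hQR | hQR
  · obtain ⟨Φ, hlift, hΦ, x, y, hx0, hy0, rfl, rfl, hx, hy, hxy, hΦx, -⟩ :=
      HasGoodReductionAt.exists_lifts_of_dist_lt_one hQ hQR
    obtain ⟨hΦx0, hφx⟩ := hlift.2 x hx0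
    obtain ⟨hΦy0, hφy⟩ := hlift.2 y hy0
    calc chordalDist (φ.toFun (.mk K x hx0)) (φ.toFun (.mk K y hy0))
        = chordalAux (evalMap Φ x) (evalMap Φ y) := by rw [hφx, hφy, chordalDist_mk]
      _ ≤ ‖evalMap Φ x - evalMap Φ y‖ := by
        simpa only [hΦx, div_one] using chordalAux_le_norm_sub_div (evalMap Φ x) hΦy0
      _ ≤ ‖x - y‖ := norm_evalMap_sub_le hΦ.le hx.le hy.le
      _ ≤ chordalDist (.mk K x hx0) (.mk K y hy0) := hxy
  · exact (chordalAux_le_one _ _).trans hQR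

end GoodLocus

section UniquenessOfLifts

theorem exists_eq_mul_of_span_range_eq_top {R ι : Type*} [CommRing R] {p q : ι → R}
    (hp : Ideal.span (Set.range p) = ⊤) (hpq : ∀ i j, p i * q j = p j * q i) :
    ∃ g, ∀ j, q j = g * p j := by
  obtain ⟨c, hc⟩ := Finsupp.mem_ideal_span_range_iff_exists_finsupp.1
    ((Ideal.eq_top_iff_one _).1 hp)
  refine ⟨c.sum fun i a => a * q i, fun j => ?_⟩
  calc q j = (c.sum fun i a => a * p i) * q j := by rw [hc, one_mul]
    _ = (c.sum fun i a => a * q i) * p j := by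
      simp only [Finsupp.sum, Finset.sum_mul, mul_assoc, hpq, mul_comm (q _)]

theorem exists_polynomial_eval_eq_eval_lineMap {R σ : Type*} [CommRing R] (x y : σ → R)
    (p : MvPolynomial σ R) :
    ∃ q : Polynomial R, ∀ t, q.eval t = eval (AffineMap.lineMap x y t) p := by
  refine ⟨aeval (fun i => Polynomial.C (x i) + Polynomial.X * Polynomial.C (y i - x i)) p,
    fun t => ?_⟩
  rw [← Polynomial.coe_aeval_eq_eval, ← AlgHom.comp_apply, comp_aeval, ← aeval_eq_eval]
  congr 2
  ext i
  simp [AffineMap.lineMap_apply, add_comm]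

variable {K : Type*} [Field K] {N d : ℕ} {Φ Ψ : Fin (N + 1) → MvPolynomial (Fin (N + 1)) K}
  {f : PSpace K N → PSpace K N} {x y : Fin (N + 1) → K}

theorem IsLift.exists_eval_ne_zero (hΦ : IsLift d Φ f) (hx : x ≠ 0) : ∃ i, eval x (Φ i) ≠ 0 :=
  Function.ne_iff.1 (hΦ.2 x hx).1

theorem IsLift.exists_evalMap_eq_smul (hΦ : IsLift d Φ f) (hΨ : IsLift d Ψ f) (hx : x ≠ 0) :
    ∃ c : K, evalMap Ψ x = c • evalMap Φ x := by
  obtain ⟨_, hΦx⟩ := hΦ.2 x hx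
  obtain ⟨_, hΨx⟩ := hΨ.2 x hx
  obtain ⟨c, hc⟩ := (Projectivization.mk_eq_mk_iff' K _ _ _ _).1 (hΨx.symm.trans hΦx)
  exact ⟨c, hc.symm⟩

theorem IsLift.eval_mul_eval_eq (hΦ : IsLift d Φ f) (hΨ : IsLift d Ψ f) (hx : x ≠ 0)
    (i j : Fin (N + 1)) : eval x (Φ i) * eval x (Ψ j) = eval x (Φ j) * eval x (Ψ i) := by
  obtain ⟨c, hc⟩ := hΦ.exists_evalMap_eq_smul hΨ hx
  have hsmul : ∀ i, eval x (Ψ i) = c * eval x (Φ i) := congrFun hc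
  rw [hsmul, hsmul]
  ring

variable [IsAlgClosed K]

theorem span_range_eq_top_of_forall_exists_eval_ne_zero {ι : Type*} {p : ι → Polynomial K}
    (hp : ∀ t, ∃ i, (p i).eval t ≠ 0) : Ideal.span (Set.range p) = ⊤ := by
  obtain ⟨g, hg⟩ := IsPrincipalIdealRing.principal (Ideal.span (Set.range p))
  rw [hg, Ideal.submodule_span_eq, Ideal.span_singleton_eq_top,
    Polynomial.isUnit_iff_degree_eq_zero]
  by_contra hdegree
  obtain ⟨t, ht⟩ := IsAlgClosed.exists_root g hdegree
  obtain ⟨i, hi⟩ := hp t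
  have hdvd : g ∣ p i := Ideal.mem_span_singleton.1
    (hg.le (Ideal.subset_span ⟨i, rfl⟩))
  exact hi (ht.dvd hdvd)

theorem exists_eq_C_mul_of_mul_eq_mul {ι : Type*} {p q : ι → Polynomial K}
    (hp : ∀ t, ∃ i, (p i).eval t ≠ 0) (hq : ∀ t, ∃ i, (q i).eval t ≠ 0)
    (hpq : ∀ i j, p i * q j = p j * q i) : ∃ c, ∀ i, q i = Polynomial.C c * p i := by
  obtain ⟨g, hg⟩ := exists_eq_mul_of_span_range_eq_top
    (span_range_eq_top_of_forall_exists_eval_ne_zero hp) hpq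
  have hdegree : g.degree = 0 := by
    by_contra hdegree
    obtain ⟨t, ht⟩ := IsAlgClosed.exists_root g hdegree
    obtain ⟨i, hi⟩ := hq t
    exact hi (by rw [hg, Polynomial.eval_mul, ht.eq_zero, zero_mul])
  exact ⟨g.coeff 0, Polynomial.eq_C_of_degree_eq_zero hdegree ▸ hg⟩

theorem IsLift.exists_evalMap_eq_smul_of_linearIndependent (hΦ : IsLift d Φ f)
    (hΨ : IsLift d Ψ f) (hxy : LinearIndependent K ![x, y]) :
    ∃ c : K, evalMap Ψ x = c • evalMap Φ x ∧ evalMap Ψ y = c • evalMap Φ y := by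
  have hline : ∀ t : K, AffineMap.lineMap x y t ≠ 0 := fun t ht => by
    rw [AffineMap.lineMap_apply_module] at ht
    obtain ⟨h1, h0⟩ := LinearIndependent.pair_iff.1 hxy _ _ ht
    exact one_ne_zero (by rw [← sub_zero (1 : K), ← h0, h1, h0])
  choose p hp using fun i => exists_polynomial_eval_eq_eval_lineMap x y (Φ i)
  choose q hq using fun i => exists_polynomial_eval_eq_eval_lineMap x y (Ψ i)
  obtain ⟨c, hc⟩ := exists_eq_C_mul_of_mul_eq_mul (p := p) (q := q)
    (fun t => by simpa only [hp] using hΦ.exists_eval_ne_zero (hline t))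
    (fun t => by simpa only [hq] using hΨ.exists_eval_ne_zero (hline t)) fun i j =>
      Polynomial.funext fun t => by
        simpa only [Polynomial.eval_mul, hp, hq] using hΦ.eval_mul_eval_eq hΨ (hline t) i j
  have heval : ∀ t i, eval (AffineMap.lineMap x y t) (Ψ i) =
      c * eval (AffineMap.lineMap x y t) (Φ i) := fun t i => by
    rw [← hp, ← hq, hc, Polynomial.eval_mul, Polynomial.eval_C]
  simp only [funext_iff, evalMap, Pi.smul_apply, smul_eq_mul]
  exact ⟨c, by simpa only [AffineMap.lineMap_apply_zero] using heval 0,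
    by simpa only [AffineMap.lineMap_apply_one] using heval 1⟩

theorem IsLift.exists_eq_C_mul (hΦ : IsLift d Φ f) (hΨ : IsLift d Ψ f) :
    ∃ c, ∀ i, Ψ i = C c * Φ i := by
  have : Infinite K := IsAlgClosed.instInfinite
  obtain ⟨c, hc⟩ := hΦ.exists_evalMap_eq_smul hΨ one_ne_zero
  suffices hsmul : ∀ x, evalMap Ψ x = c • evalMap Φ x from
    ⟨c, fun i => MvPolynomial.funext fun x => by
      rw [map_mul, eval_C]
      exact congrFun (hsmul x) i⟩
  intro x
  by_cases hx : LinearIndependent K ![1, x]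
  · obtain ⟨c', hc', hcx⟩ := hΦ.exists_evalMap_eq_smul_of_linearIndependent hΨ hx
    obtain rfl : c' = c := smul_left_injective K (hΦ.2 1 one_ne_zero).1 (hc'.symm.trans hc)
    exact hcx
  · obtain ⟨a, rfl⟩ : ∃ a : K, a • 1 = x := by
      simpa only [LinearIndependent.pair_iff' one_ne_zero, not_forall, not_not] using hx
    rw [evalMap_smul hΨ.1, evalMap_smul hΦ.1, hc, smul_comm]

end UniquenessOfLifts

section Elimination

variable {A K : Type*} [CommRing A] [Field K]

theorem exists_smul_mem_span_of_span_image_eq_top {m : Type*} [Finite m] (f : A →+* K)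
    {S : Set (m → A)} (hS : Submodule.span K ((f ∘ ·) '' S) = ⊤) :
    ∃ a, f a ≠ 0 ∧ ∀ v, a • v ∈ Submodule.span A S := by
  classical
  cases nonempty_fintype m
  obtain ⟨κ, s, -, hspan, hli⟩ := exists_linearIndependent' K fun v : S => f ∘ (v : m → A)
  rw [← Set.image_eq_range (f ∘ ·), hS] at hspan
  let e : m ≃ κ := (Pi.basisFun K m).indexEquiv (.mk hli hspan.ge)
  let M : Matrix m m A := .of fun i j => (s (e j) : m → A) i
  have hM : IsUnit (M.map f) :=
    Matrix.linearIndependent_cols_iff_isUnit.1 (hli.comp e e.injective)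
  refine ⟨M.det, ?_, fun v => ?_⟩
  · rw [RingHom.map_det]
    exact ((Matrix.isUnit_iff_isUnit_det _).1 hM).ne_zero
  · have hdet : M.det • v = M.mulVec (M.adjugate.mulVec v) := by
      rw [Matrix.mulVec_mulVec, Matrix.mul_adjugate, Matrix.smul_mulVec, Matrix.one_mulVec]
    rw [hdet, Matrix.mulVec_eq_sum]
    refine sum_mem fun j _ => ?_
    rw [op_smul_eq_smul]
    exact Submodule.smul_mem _ _ (Submodule.subset_span (s (e j)).2)

variable {σ ι : Type*} {F : ι → MvPolynomial σ A} {d D : ℕ}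

/-- The products of degree `D` of a monomial with one of the forms `F i` of degree `d`. They span
the degree `D` part of the ideal generated by the `F i`; their coefficients are the columns of
Macaulay's matrix. The degree condition is written additively to avoid truncated subtraction. -/
def monomialMultiples (F : ι → MvPolynomial σ A) (d D : ℕ) : Set (MvPolynomial σ A) :=
  {q | ∃ i, ∃ γ : σ →₀ ℕ, γ.degree + d = D ∧ q = monomial γ 1 * F i}

/-- The vector of the coefficients of a polynomial in degree `D`, which determines a form of
degree `D`. -/
noncomputable def homogeneousCoeffs (A : Type*) {σ : Type*} [CommRing A] (D : ℕ) :
    MvPolynomial σ A →ₗ[A] ({β : σ →₀ ℕ // β.degree = D} → A) :=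
  .pi fun β => lcoeff A β

theorem homogeneousCoeffs_injOn :
    Set.InjOn (homogeneousCoeffs A D) {p : MvPolynomial σ A | p.IsHomogeneous D} := by
  intro p hp q hq hpq
  ext β
  by_cases hβ : β.degree = D
  · exact congrFun hpq ⟨β, hβ⟩
  · rw [hp.coeff_eq_zero hβ, hq.coeff_eq_zero hβ]

theorem homogeneousCoeffs_monomial [DecidableEq {β : σ →₀ ℕ // β.degree = D}]
    (β : {β : σ →₀ ℕ // β.degree = D}) (a : A) :
    homogeneousCoeffs A D (monomial β a) = Pi.single β a := by
  classical
  funext α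
  simp only [homogeneousCoeffs, LinearMap.pi_apply, lcoeff_apply, coeff_monomial,
    Pi.single_apply, Subtype.ext_iff, eq_comm]

theorem homogeneousCoeffs_map {B : Type*} [CommRing B] (f : A →+* B) (p : MvPolynomial σ A) :
    homogeneousCoeffs B D (map f p) = f ∘ homogeneousCoeffs A D p :=
  funext fun β => coeff_map f p β

theorem image_map_monomialMultiples {B : Type*} [CommRing B] (f : A →+* B) :
    map f '' monomialMultiples F d D = monomialMultiples (fun i => map f (F i)) d D := by
  ext q
  constructor
  · rintro ⟨_, ⟨i, γ, hγ, rfl⟩, rfl⟩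
    exact ⟨i, γ, hγ, by rw [map_mul, map_monomial, map_one]⟩
  · rintro ⟨i, γ, hγ, rfl⟩
    exact ⟨_, ⟨i, γ, hγ, rfl⟩, by rw [map_mul, map_monomial, map_one]⟩

theorem span_monomialMultiples_le_homogeneousSubmodule (hF : ∀ i, (F i).IsHomogeneous d) :
    Submodule.span A (monomialMultiples F d D) ≤ homogeneousSubmodule σ A D := by
  rw [Submodule.span_le]
  rintro _ ⟨i, γ, rfl, rfl⟩
  exact (isHomogeneous_monomial 1 rfl).mul (hF i)

theorem span_monomialMultiples_le_span_range :
    Submodule.span A (monomialMultiples F d D) ≤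
      (Ideal.span (Set.range F)).restrictScalars A := by
  rw [Submodule.span_le]
  rintro _ ⟨i, γ, -, rfl⟩
  exact Ideal.mul_mem_left _ _ (Ideal.subset_span ⟨i, rfl⟩)

theorem homogeneousComponent_mem_span_monomialMultiples (hF : ∀ i, (F i).IsHomogeneous d)
    {p : MvPolynomial σ A} (hp : p ∈ Ideal.span (Set.range F)) :
    homogeneousComponent D p ∈ Submodule.span A (monomialMultiples F d D) := by
  have hmul : ∀ i a, homogeneousComponent D (a * F i) ∈
      Submodule.span A (monomialMultiples F d D) := by
    intro i a
    induction a using MvPolynomial.induction_on' with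
    | add p q hp hq =>
      rw [add_mul, map_add]
      exact add_mem hp hq
    | monomial γ a =>
      rw [homogeneousComponent_of_mem ((isHomogeneous_monomial a rfl).mul (hF i))]
      split_ifs with hγ
      · have hsmul : monomial γ a * F i = a • (monomial γ 1 * F i) := by
          rw [← smul_mul_assoc, smul_monomial, smul_eq_mul, mul_one]
        rw [hsmul]
        exact Submodule.smul_mem _ _ (Submodule.subset_span ⟨i, γ, hγ.symm, rfl⟩)
      · exact zero_mem _
  obtain ⟨c, rfl⟩ := Finsupp.mem_ideal_span_range_iff_exists_finsupp.1 hp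
  rw [Finsupp.sum, map_sum]
  exact sum_mem fun i _ => hmul i (c i)

theorem span_homogeneousCoeffs_monomialMultiples_eq_top [Finite σ]
    (hF : ∀ i, (F i).IsHomogeneous d)
    (hD : ∀ β : σ →₀ ℕ, β.degree = D → monomial β 1 ∈ Ideal.span (Set.range F)) :
    Submodule.span A (homogeneousCoeffs A D '' monomialMultiples F d D) = ⊤ := by
  classical
  have : Finite {β : σ →₀ ℕ // β.degree = D} := Finsupp.finite_of_degree_eq D
  rw [eq_top_iff, ← (Pi.basisFun A _).span_eq, Submodule.span_le, Submodule.span_image]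
  rintro _ ⟨β, rfl⟩
  refine ⟨monomial β 1, ?_, by rw [homogeneousCoeffs_monomial, Pi.basisFun_apply]⟩
  rw [← homogeneousComponent_eq_self (isHomogeneous_monomial 1 β.2)]
  exact homogeneousComponent_mem_span_monomialMultiples hF (hD β β.2)

theorem exists_forall_monomial_mem_of_X_mem_radical [Finite σ] {I : Ideal (MvPolynomial σ A)}
    (hI : ∀ j, X j ∈ I.radical) : ∃ D, ∀ β : σ →₀ ℕ, β.degree = D → monomial β 1 ∈ I := by
  cases nonempty_fintype σ
  choose k hk using hI
  refine ⟨∑ j, k j + 1, fun β hβ => ?_⟩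
  obtain ⟨j, -, hj⟩ : ∃ j ∈ Finset.univ, k j < β j :=
    Finset.exists_lt_of_sum_lt (by rw [← Finsupp.degree_eq_sum, hβ]; exact Nat.lt_succ_self _)
  refine Ideal.mem_of_dvd _ ?_ (hk j)
  rw [X_pow_eq_monomial, monomial_dvd_monomial]
  exact ⟨Or.inr (Finsupp.single_le_iff.2 hj.le), one_dvd _⟩

theorem exists_C_mul_X_pow_mem_span_range [Finite σ] (f : A →+* K)
    (hF : ∀ i, (F i).IsHomogeneous d)
    (hX : ∀ j, X j ∈ (Ideal.span (Set.range fun i => map f (F i))).radical) :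
    ∃ a, f a ≠ 0 ∧ ∃ k : ℕ, ∀ j, C a * X j ^ k ∈ Ideal.span (Set.range F) := by
  obtain ⟨D, hD⟩ := exists_forall_monomial_mem_of_X_mem_radical hX
  have hspan : Submodule.span K
      ((f ∘ ·) '' (homogeneousCoeffs A D '' monomialMultiples F d D)) = ⊤ := by
    simpa only [← image_map_monomialMultiples, Set.image_image, homogeneousCoeffs_map] using
      span_homogeneousCoeffs_monomialMultiples_eq_top (fun i => (hF i).map f) hD
  have : Finite {β : σ →₀ ℕ // β.degree = D} := Finsupp.finite_of_degree_eq D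
  obtain ⟨a, ha, hmem⟩ := exists_smul_mem_span_of_span_image_eq_top f hspan
  refine ⟨a, ha, D, fun j => ?_⟩
  rw [Submodule.span_image] at hmem
  obtain ⟨q, hq, hqX⟩ := hmem (homogeneousCoeffs A D (X j ^ D))
  have hqX : q = C a * X j ^ D :=
    homogeneousCoeffs_injOn (span_monomialMultiples_le_homogeneousSubmodule hF hq)
      ((isHomogeneous_X_pow j D).C_mul a) (by rw [hqX, ← smul_eq_C_mul, map_smul])
  exact hqX ▸ span_monomialMultiples_le_span_range hq

end Elimination

section Resultant

/-- The specialization `ℤ[u] → R` sending each `u_{i,α}` to the coefficient of `X^α` in `Φ i`;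
`evalCoeffs` is its value, and it maps the generic forms to `Φ`. -/
noncomputable def coeffSpecialization {R : Type*} [CommRing R] {N d : ℕ}
    (Φ : Fin (N + 1) → MvPolynomial (Fin (N + 1)) R) : CoeffRing N d →+* R :=
  (aeval fun p : Fin (N + 1) × Expo N d => (Φ p.1).coeff p.2).toRingHom

theorem mem_finsuppAntidiag_univ_iff_degree_eq {σ : Type*} [Fintype σ] [DecidableEq σ] {d : ℕ}
    {α : σ →₀ ℕ} : α ∈ (Finset.univ : Finset σ).finsuppAntidiag d ↔ α.degree = d := by
  simp [Finset.mem_finsuppAntidiag, Finsupp.degree_eq_sum]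

theorem isHomogeneous_genericForm (N d : ℕ) (i : Fin (N + 1)) :
    (genericForm N d i).IsHomogeneous d :=
  .sum _ _ _ fun α _ =>
    isHomogeneous_monomial _ (mem_finsuppAntidiag_univ_iff_degree_eq.1 α.2)

theorem map_genericForm {R : Type*} [CommRing R] {N d : ℕ}
    {Φ : Fin (N + 1) → MvPolynomial (Fin (N + 1)) R} {i : Fin (N + 1)}
    (hΦ : (Φ i).IsHomogeneous d) : map (coeffSpecialization Φ) (genericForm N d i) = Φ i := by
  have hcoeff : ∀ α : Expo N d, coeffSpecialization Φ (X (i, α)) = (Φ i).coeff α :=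
    fun α => aeval_X _ _
  have hsupport : (Φ i).support ⊆ Finset.univ.finsuppAntidiag d := fun α hα =>
    mem_finsuppAntidiag_univ_iff_degree_eq.2 <| by_contra fun h =>
      mem_support_iff.1 hα (hΦ.coeff_eq_zero h)
  simp only [genericForm, map_sum, map_monomial, hcoeff]
  rw [Finset.sum_coe_sort _ fun α => monomial α ((Φ i).coeff α)]
  conv_rhs => rw [(Φ i).as_sum]
  refine (Finset.sum_subset hsupport fun α _ hα => ?_).symm
  rw [notMem_support_iff.1 hα, monomial_zero]

end Resultant

section ResultantOfLift

variable {K : Type*} [Field K] [IsAlgClosed K] {N d : ℕ}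
  {Φ : Fin (N + 1) → MvPolynomial (Fin (N + 1)) K} {f : PSpace K N → PSpace K N}

theorem IsLift.X_mem_radical (hΦ : IsLift d Φ f) (j : Fin (N + 1)) :
    X j ∈ (Ideal.span (Set.range Φ)).radical := by
  rw [← vanishingIdeal_zeroLocus_eq_radical (K := K), mem_vanishingIdeal_iff]
  intro x hx
  rw [zeroLocus_span] at hx
  have hx0 : x = 0 := by
    by_contra hne
    obtain ⟨i, hi⟩ := hΦ.exists_eval_ne_zero hne
    exact hi (hx (Φ i) ⟨i, rfl⟩)
  rw [aeval_X, hx0, Pi.zero_apply]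

theorem IsLift.exists_mem_resultantIdeal (hΦ : IsLift d Φ f) :
    ∃ a ∈ resultantIdeal N d, evalCoeffs a Φ ≠ 0 := by
  obtain ⟨a, ha, hmem⟩ := exists_C_mul_X_pow_mem_span_range (coeffSpecialization Φ)
    (isHomogeneous_genericForm N d) fun j => by
      simpa only [map_genericForm (hΦ.1 _)] using hΦ.X_mem_radical j
  exact ⟨a, hmem, ha⟩

theorem IsLift.resultant_ne_zero (hΦ : IsLift d Φ f) : resultant d Φ ≠ 0 := by
  obtain ⟨a, ha, hne⟩ := hΦ.exists_mem_resultantIdeal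
  have hdvd : resultantPoly N d ∣ a := by
    unfold resultantPoly
    split_ifs
    · exact neg_dvd.2 ((dvd_preResultant_iff N d _).1 dvd_rfl a ha)
    · exact (dvd_preResultant_iff N d _).1 dvd_rfl a ha
  exact fun hzero => hne (zero_dvd_iff.1 (hzero ▸ map_dvd (coeffSpecialization Φ) hdvd))

end ResultantOfLift

section NormResultant

variable {K : Type*} [NormedField K] [IsUltrametricDist K] {N d : ℕ}
  {Φ : Fin (N + 1) → MvPolynomial (Fin (N + 1)) K}

theorem norm_resultant_le_one (hΦ : coeffNorm Φ ≤ 1) : ‖resultant d Φ‖ ≤ 1 :=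
  norm_aeval_int_le_one _ fun p => (norm_coeff_le_coeffNorm Φ p.1 p.2).trans hΦ

theorem IsMinimalResultant.norm_mem_Ioc [IsAlgClosed K] {φ : ProjMorphism K N d} {ρ : K}
    (hρ : IsMinimalResultant φ ρ) : ‖ρ‖ ∈ Set.Ioc 0 1 := by
  obtain ⟨Φ, hΦ, rfl⟩ := hρ
  obtain ⟨hlift, hnorm⟩ := isMinimalLift_iff_coeffNorm_eq_one.1 hΦ
  exact ⟨norm_pos_iff.2 hlift.resultant_ne_zero, norm_resultant_le_one hnorm.le⟩

end NormResultant

section EscapeRate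

variable {K : Type*} [NormedField K] {N d : ℕ}
  {Φ : Fin (N + 1) → MvPolynomial (Fin (N + 1)) K}

theorem exists_mk_eq_norm_eq_one (P : PSpace K N) :
    ∃ (x : Fin (N + 1) → K) (hx : x ≠ 0), .mk K x hx = P ∧ ‖x‖ = 1 := by
  obtain ⟨i, hi⟩ := exists_norm_apply_eq P.rep
  have hPi : P.rep i ≠ 0 := norm_ne_zero_iff.1 (hi ▸ norm_ne_zero_iff.2 P.rep_nonzero)
  refine ⟨(P.rep i)⁻¹ • P.rep, smul_ne_zero (inv_ne_zero hPi) P.rep_nonzero, ?_, ?_⟩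
  · conv_rhs => rw [← P.mk_rep]
    exact (Projectivization.mk_eq_mk_iff' K _ _ _ _).2 ⟨_, rfl⟩
  · rw [norm_smul, norm_inv, hi, inv_mul_cancel₀ (norm_ne_zero_iff.2 P.rep_nonzero)]

theorem gFun_mk_eq_zero_iff (hd : d ≠ 0) {f : PSpace K N → PSpace K N} (hΦ : IsLift d Φ f)
    {x : Fin (N + 1) → K} (hx0 : x ≠ 0) (hx : ‖x‖ = 1) :
    gFun d Φ (.mk K x hx0) = 0 ↔ ‖evalMap Φ x‖ = 1 := by
  have hpos : 0 < ‖evalMap Φ x‖ := norm_pos_iff.2 (hΦ.2 x hx0).1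
  rw [gFun_mk hd hΦ, hx, Real.log_one, sub_zero, mul_eq_zero_iff_left (by positivity)]
  exact ⟨Real.eq_one_of_pos_of_log_eq_zero hpos, fun h => by rw [h, Real.log_one]⟩

theorem mem_goodLocus_iff_gFun_eq_zero [IsAlgClosed K] (hd : d ≠ 0) {φ : ProjMorphism K N d}
    (hΦ : IsMinimalLift φ Φ) (P : PSpace K N) : P ∈ goodLocus φ ↔ gFun d Φ P = 0 := by
  obtain ⟨hlift, hnorm⟩ := isMinimalLift_iff_coeffNorm_eq_one.1 hΦ
  constructor
  · rintro ⟨Ψ, hΨ, x, hx0, rfl, hx, hΨnorm, hΨx⟩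
    obtain ⟨c, hc⟩ := hΨ.exists_eq_C_mul hlift
    obtain rfl : Φ = fun i => C c * Ψ i := funext hc
    have hc1 : ‖c‖ = 1 := by rwa [coeffNorm_C_mul, hΨnorm, mul_one] at hnorm
    have heval : evalMap (fun i => C c * Ψ i) x = c • evalMap Ψ x :=
      funext fun i => by simp only [evalMap, map_mul, eval_C, Pi.smul_apply, smul_eq_mul]
    rw [gFun_mk_eq_zero_iff hd hlift hx0 hx, heval, norm_smul, hc1, hΨx, mul_one]
  · obtain ⟨x, hx0, rfl, hx⟩ := exists_mk_eq_norm_eq_one P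
    rw [gFun_mk_eq_zero_iff hd hlift hx0 hx]
    exact fun hΦx => ⟨Φ, hlift, x, hx0, rfl, hx, hnorm, hΦx⟩

end EscapeRate

end GoodReduction

theorem proposition31_general {K : Type*} [NormedField K] [IsUltrametricDist K] [IsAlgClosed K]
    (N d : ℕ) (hd : d ≠ 0) (φ : ProjMorphism K N d) :
    (∀ Φ : Fin (N + 1) → MvPolynomial (Fin (N + 1)) K, IsMinimalLift φ Φ →
      ∀ r ∈ Set.Ioc (0 : ℝ) 1, ∀ P : PSpace K N,
        (P ∈ goodLocus φ ↔ disk P r ⊆ goodLocus φ) ∧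
        (disk P r ⊆ goodLocus φ ↔ gFun d Φ P = 0) ∧
        (gFun d Φ P = 0 → NonexpandingOn φ (disk P r)) ∧
        (NonexpandingOn φ (disk P r) → ∃ U ∈ nhds P, NonexpandingOn φ U)) ∧
    IsOpen (goodLocus φ) := by
  refine ⟨fun Φ hΦ r hr P => ?_, isOpen_goodLocus φ⟩
  have hdisk : P ∈ goodLocus φ ↔ disk P r ⊆ goodLocus φ :=
    ⟨fun hP => disk_subset_goodLocus hP hr.2, fun h => h (mem_of_mem_nhds (disk_mem_nhds P hr.1))⟩
  have hgFun : P ∈ goodLocus φ ↔ gFun d Φ P = 0 := mem_goodLocus_iff_gFun_eq_zero hd hΦ P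
  refine ⟨hdisk, hdisk.symm.trans hgFun, fun h Q hQ R hR => ?_,
    fun h => ⟨_, disk_mem_nhds P hr.1, h⟩⟩
  have hgood : disk P r ⊆ goodLocus φ := hdisk.1 (hgFun.2 h)
  exact nonexpandingOn_goodLocus φ Q (hgood hQ) R (hgood hR)

theorem proposition31 {K : Type*} [NontriviallyNormedField K] [IsUltrametricDist K]
    [CompleteSpace K] [IsAlgClosed K] (N d : ℕ) (hd : 2 ≤ d) (φ : ProjMorphism K N d) :
    (∀ Φ : Fin (N + 1) → MvPolynomial (Fin (N + 1)) K, IsMinimalLift φ Φ →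
      ∀ ρ : K, IsMinimalResultant φ ρ → ∀ P : PSpace K N,
        (P ∈ goodLocus φ ↔ disk P ‖ρ‖ ⊆ goodLocus φ) ∧
        (disk P ‖ρ‖ ⊆ goodLocus φ ↔ gFun d Φ P = 0) ∧
        (gFun d Φ P = 0 → NonexpandingOn φ (disk P ‖ρ‖)) ∧
        (NonexpandingOn φ (disk P ‖ρ‖) → ∃ U ∈ nhds P, NonexpandingOn φ U)) ∧
    IsOpen (goodLocus φ) := by
  obtain ⟨h, hopen⟩ := proposition31_general N d (by omega) φ
  exact ⟨fun Φ hΦ ρ hρ => h Φ hΦ ‖ρ‖ hρ.norm_mem_Ioc, hopen⟩
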